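/- Let $\varphi=\frac{1+\sqrt5}{2}$ and $\psi=\frac{1-\sqrt5}{2}=-1/\varphi$. For $W\subset\mathbb{R}$ let $\Lambda(W)=\{a+b\varphi : a,b\in\mathbb{Z},\ a+b\psi\in W\}$ be the cut-and-project set with window $W$ obtained from the lattice in $\mathbb{R}^2$ spanned by $(1,1)$ and $(\varphi,\psi)$; the Fibonacci set is $\Lambda([-1/\varphi,1))$, whose window has length $\varphi$. A half-Fibonacci set is a set $\Lambda(W)$, where $W$ is an interval of length $\varphi/2$, with or without its endpoints (for example one of the two halves of the window $[-1/\varphi,1)$). The hull of a set $\Lambda\subset\mathbb{R}$ is the closure of $\{\Lambda-t : t\in\mathbb{R}\}$ in the space of closed subsets of $\mathbb{R}$ with respect to the Chabauty–Fell topology, that is, the topology of the metric $$D(\Lambda_0,\Lambda_1)=\inf\Big(\big\{\varepsilon>0 : \Lambda_0\cap(-\tfrac1\varepsilon,\tfrac1\varepsilon)\subset\Lambda_1^{(+\varepsilon)},\ \Lambda_1\cap(-\tfrac1\varepsilon,\tfrac1\varepsilon)\subset\Lambda_0^{(+\varepsilon)}\big\}\cup\{1\}\Big),$$ where $A^{(+\varepsilon)}$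 is the set of points at distance at most $\varepsilon$ from $A$. Two sets $\Lambda,\Gamma\subset\mathbb{R}$ are bounded displacement (BD) equivalent if there is a bijection $\phi:\Lambda\to\Gamma$ with $\sup_{x\in\Lambda}|x-\phi(x)|<\infty$. Corollary (half-Fibonacci sets). All half-Fibonacci sets have the same hull $\mathbb{X}$ and belong to it, every element of $\mathbb{X}$ is a Delone set (uniformly discrete and relatively dense), and the set of BD-equivalence classes represented in $\mathbb{X}$ has cardinality exactly $2^{\aleph_0}$. -/

import Mathlib

open Set

noncomputable section

namespace HalfFib

/-- A subset of the line is a Delone set if it is the point set of one of Mathlib's (bundled)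
Delone sets, i.e. if it is uniformly discrete and relatively dense for some choice of radii. -/
def IsDelone (Λ : Set ℝ) : Prop := ∃ D : Delone.DeloneSet ℝ, D.carrier = Λ

/-- The Chabauty--Fell metric on closed subsets of the line. -/
def chabautyFellDist (Λ₀ Λ₁ : Set ℝ) : ℝ :=
  sInf ({ε : ℝ | 0 < ε ∧
      Λ₀ ∩ Metric.ball 0 (1 / ε) ⊆ Metric.cthickening ε Λ₁ ∧
      Λ₁ ∩ Metric.ball 0 (1 / ε) ⊆ Metric.cthickening ε Λ₀} ∪ {1})

/-- The translate `Λ - t`. -/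
def translate (Λ : Set ℝ) (t : ℝ) : Set ℝ := (fun x => x - t) '' Λ

/-- The hull of `Λ`: the closure of the orbit of `Λ` under translations, in the space of closed
subsets of the line with the Chabauty--Fell metric. -/
def hull (Λ : Set ℝ) : Set (Set ℝ) :=
  {Γ | IsClosed Γ ∧ ∀ ε : ℝ, 0 < ε → ∃ t : ℝ, chabautyFellDist Γ (translate Λ t) < ε}

/-- Bounded displacement equivalence: there is a bijection that moves points by a bounded
amount. -/
def BDEquiv (Λ Γ : Set ℝ) : Prop :=
  ∃ f : Λ ≃ Γ, ∃ C : ℝ, ∀ x : Λ, |(x : ℝ) - (f x : ℝ)| ≤ C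

theorem BDEquiv.refl (Λ : Set ℝ) : BDEquiv Λ Λ :=
  ⟨Equiv.refl _, 0, fun x => by simp⟩

theorem BDEquiv.symm {Λ Γ : Set ℝ} (h : BDEquiv Λ Γ) : BDEquiv Γ Λ := by
  obtain ⟨f, C, hC⟩ := h
  refine ⟨f.symm, C, fun y => ?_⟩
  have := hC (f.symm y)
  rw [Equiv.apply_symm_apply] at this
  rwa [abs_sub_comm]

theorem BDEquiv.trans {Λ Γ Δ : Set ℝ} (h : BDEquiv Λ Γ) (h' : BDEquiv Γ Δ) : BDEquiv Λ Δ := by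
  obtain ⟨f, C, hC⟩ := h
  obtain ⟨g, C', hC'⟩ := h'
  refine ⟨f.trans g, C + C', fun x => ?_⟩
  have h₁ := hC x
  have h₂ := hC' (f x)
  exact (abs_sub_le _ (f x : ℝ) _).trans (add_le_add h₁ h₂)

/-- BD-equivalence on the members of a family of point sets. -/
def bdSetoid (X : Set (Set ℝ)) : Setoid X where
  r Λ Γ := BDEquiv Λ Γ
  iseqv := ⟨fun _ => BDEquiv.refl _, BDEquiv.symm, BDEquiv.trans⟩

/-- The cardinality of the set of BD-classes represented in `X`. -/
def bdCard (X : Set (Set ℝ)) : Cardinal := Cardinal.mk (Quotient (bdSetoid X))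

/-- The cut-and-project set with window `W` in the Fibonacci cut-and-project scheme: project to
the first coordinate those points of the lattice in the plane spanned by `(1, 1)` and `(φ, ψ)`
whose second coordinate lies in `W`. Here `φ` is the golden ratio and `ψ = -1/φ` its conjugate.
The Fibonacci set itself has the window `[-1/φ, 1)`, of length `φ`. -/
def fibonacciCutAndProject (W : Set ℝ) : Set ℝ :=
  {x | ∃ a b : ℤ, x = a + b * Real.goldenRatio ∧ (a + b * Real.goldenConj : ℝ) ∈ W}

/-- A half-Fibonacci set: the window is an interval (with or without its endpoints) of half the
length of the Fibonacci window. -/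
def IsHalfFibonacci (Λ : Set ℝ) : Prop :=
  ∃ (s : ℝ) (W : Set ℝ), Ioo s (s + Real.goldenRatio / 2) ⊆ W ∧
    W ⊆ Icc s (s + Real.goldenRatio / 2) ∧ Λ = fibonacciCutAndProject W

end HalfFib

end

/-! The hull. Moving the window of one half-Fibonacci set close to that of another changes the
membership of only finitely many lattice points over a bounded region, and density of `ℤ + ℤψ`
supplies lattice translations that do this. Since `φ/2 ∉ ℤ + ℤψ`, at most one endpoint of a window
is hit by the lattice, so approaching from the correct side also reproduces the status of that
endpoint. Hence all patches are shared (`IsHalfFibonacci.patches`) and all hulls agree. Separation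
comes from the norm form of `ℤ[φ]`, relative density from the rotation by `ψ`, and both pass to
limits.

The classes. The points of `halfFibonacci u` are indexed by the times `b` at which the orbit of `0`
under rotation by `ψ` visits the arc `[u, u + φ/2)`, and the point of index `b` is within bounded
distance of `b(φ - ψ)`. BD-equivalence of the sets for `u` and `v` therefore bounds the difference
of the visit counts over all blocks of times. That difference is a Birkhoff sum of a step function,
which cannot stay bounded if the jump at `u` is the only one on its orbit
(`birkhoff_sums_unbounded`). So for each `u` only countably many `v` give an equivalent set, and
there are at least continuum many classes. There are no more, since the real line has only continuum
many closed subsets. -/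

namespace HalfFib

open Filter Topology

/-! ### Recurrence and unbounded Birkhoff sums over an irrational rotation -/

/-- If all sums of an integer sequence over finite blocks are bounded, then there is a block such
that the sequence sums to zero between any two occurrences of that block. -/
theorem exists_block_sum_eq_zero {F : ℤ → ℤ} {K : ℤ}
    (hK : ∀ (m : ℤ) (n : ℕ), |∑ i ∈ Finset.range n, F (m + i)| ≤ K) :
    ∃ (m : ℤ) (n : ℕ), ∀ (k : ℤ) (d : ℕ), (∀ i < n, F (k + i) = F (m + i)) →
      (∀ i < n, F (k + d + i) = F (m + i)) → ∑ i ∈ Finset.range d, F (k + i) = 0 := by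
  -- The block is one whose sum `S` is largest in absolute value. Say `S ≥ 0`, and let `D` be the
  -- sum from one occurrence to the next. Then `D + S` is a block sum, so `D ≤ 0`; and `D` is `S`
  -- plus the sum over the gap between the occurrences, or `S` minus the sum over a final piece of
  -- the first occurrence if they overlap, so `D ≥ 0`.
  obtain ⟨M, ⟨⟨m, n⟩, hM⟩, hmax⟩ := Int.exists_greatest_of_bdd
    (P := fun z => ∃ p : ℤ × ℕ, |∑ i ∈ Finset.range p.2, F (p.1 + i)| = z)
    ⟨K, by rintro z ⟨p, rfl⟩; exact hK _ _⟩ ⟨_, ⟨(0, 0), rfl⟩⟩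
  have hle (k : ℤ) (d : ℕ) : |∑ i ∈ Finset.range d, F (k + i)| ≤ M := hmax _ ⟨(k, d), rfl⟩
  have hadd (k : ℤ) (d e : ℕ) : ∑ i ∈ Finset.range (d + e), F (k + i) =
      ∑ i ∈ Finset.range d, F (k + i) + ∑ i ∈ Finset.range e, F (k + d + i) := by
    rw [Finset.sum_range_add]
    simp [add_assoc]
  refine ⟨m, n, fun k d hk hd => ?_⟩
  have hk' : ∑ i ∈ Finset.range n, F (k + i) = ∑ i ∈ Finset.range n, F (m + i) :=
    Finset.sum_congr rfl fun i hi => hk i (Finset.mem_range.1 hi)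
  have hd' : ∑ i ∈ Finset.range n, F (k + d + i) = ∑ i ∈ Finset.range n, F (m + i) :=
    Finset.sum_congr rfl fun i hi => hd i (Finset.mem_range.1 hi)
  have h₁ := hadd k d n
  have h₂ := abs_le.1 (hle k (d + n))
  rcases le_total d n with hdn | hdn
  · obtain ⟨e, rfl⟩ := Nat.exists_eq_add_of_le hdn
    have h₃ := hadd k d e
    have h₄ := abs_le.1 (hle (k + d) e)
    rcases abs_cases (∑ i ∈ Finset.range (d + e), F (m + i)) with h | h <;>
      simp only at hM <;> omega
  · obtain ⟨e, rfl⟩ := Nat.exists_eq_add_of_le hdn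
    have h₃ := hadd k n e
    have h₄ := abs_le.1 (hle (k + n) e)
    rcases abs_cases (∑ i ∈ Finset.range n, F (m + i)) with h | h <;>
      simp only at hM <;> omega

/-- The forward orbit of an irrational rotation of the circle is dense. -/
theorem exists_nat_int_add_mul_mem_Ioo {α : ℝ} (hα : Irrational α) {x y : ℝ} (hxy : x < y) :
    ∃ (a : ℤ) (b : ℕ), (a + b * α : ℝ) ∈ Ioo x y := by
  have hd : DenseRange (fun n : ℤ => n • (α : AddCircle (1 : ℝ))) :=
    AddCircle.denseRange_zsmul_coe_iff.2 (by simpa using hα)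
  have hd' := denseRange_zsmul_iff_nsmul.1 hd
  obtain ⟨b, hb⟩ := hd'.exists_mem_open
    (QuotientAddGroup.isOpenMap_coe (Ioo x y) isOpen_Ioo)
    ((nonempty_Ioo.2 hxy).image ((↑) : ℝ → AddCircle (1 : ℝ)))
  obtain ⟨z, hz, hzb⟩ := hb
  have : ((b * α - z : ℝ) : AddCircle (1 : ℝ)) = 0 := by
    have h : ((z : ℝ) : AddCircle (1 : ℝ)) = b • (α : AddCircle (1 : ℝ)) := hzb
    rw [AddCircle.coe_sub, h, ← AddCircle.coe_nsmul, nsmul_eq_mul, sub_self]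
  obtain ⟨a, ha⟩ := (AddCircle.coe_eq_zero_iff _).1 this
  refine ⟨-a, b, ?_⟩
  have ha' : (a : ℝ) = b * α - z := by simpa using ha
  rwa [show ((-a : ℤ) + b * α : ℝ) = z by push_cast; linarith]

/-- The backward orbit of an irrational rotation of the circle is dense. -/
theorem exists_nat_int_sub_mul_mem_Ioo {α : ℝ} (hα : Irrational α) {x y : ℝ} (hxy : x < y) :
    ∃ (a : ℤ) (b : ℕ), (a - b * α : ℝ) ∈ Ioo x y := by
  obtain ⟨a, b, h⟩ := exists_nat_int_add_mul_mem_Ioo hα.neg hxy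
  exact ⟨a, b, by simpa [sub_eq_add_neg] using h⟩

/-- A property that holds for all points close to `x` on the right holds for a point of
`ℤ + ℤ α`. -/
theorem exists_int_add_mul_of_eventually_gt {α : ℝ} (hα : Irrational α) {x : ℝ} {p : ℝ → Prop}
    (h : ∀ᶠ y in 𝓝[>] x, p y) : ∃ a b : ℤ, p (a + b * α) := by
  obtain ⟨z, hz, hp⟩ := (mem_nhdsGT_iff_exists_Ioo_subset).1 h
  obtain ⟨a, b, hab⟩ := exists_nat_int_add_mul_mem_Ioo hα hz
  exact ⟨a, b, by simpa using hp hab⟩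

/-- A property that holds for all points close to `x` on the left holds for a point of
`ℤ + ℤ α`. -/
theorem exists_int_add_mul_of_eventually_lt {α : ℝ} (hα : Irrational α) {x : ℝ} {p : ℝ → Prop}
    (h : ∀ᶠ y in 𝓝[<] x, p y) : ∃ a b : ℤ, p (a + b * α) := by
  obtain ⟨z, hz, hp⟩ := (mem_nhdsLT_iff_exists_Ioo_subset).1 h
  obtain ⟨a, b, hab⟩ := exists_nat_int_add_mul_mem_Ioo hα hz
  exact ⟨a, b, by simpa using hp hab⟩

/-- Let `G` be a right-continuous step function on the circle that has a jump at `u` and no other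
jump on the orbit of `u` under an irrational rotation. Then the Birkhoff sums of `G` are
unbounded. -/
theorem birkhoff_sums_unbounded {G : ℝ → ℤ} {α u : ℝ} (hα : Irrational α)
    (hper : ∀ (x : ℝ) (a : ℤ), G (x + a) = G x)
    (hright : ∀ x, ∀ᶠ y in 𝓝[≥] x, G y = G x)
    (hjump : ∀ᶠ y in 𝓝[<] u, G y = G u - 1)
    (horbit : ∀ j : ℤ, j ≠ 0 → ∀ᶠ y in 𝓝 (u + j * α), G y = G (u + j * α)) (K : ℤ) :
    ¬ ∀ (m : ℤ) (n : ℕ), |∑ i ∈ Finset.range n, G ((m + i : ℤ) * α)| ≤ K := by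
  intro hK
  obtain ⟨m, n, hmn⟩ := exists_block_sum_eq_zero (F := fun b => G (b * α)) hK
  -- By right-continuity the block recurs at every time whose orbit point falls just to the right of
  -- `mα` on the circle.
  have hev : ∀ᶠ s in 𝓝[≥] (0 : ℝ), ∀ i ∈ Finset.range n,
      G ((m + i : ℤ) * α + s) = G ((m + i : ℤ) * α) := by
    rw [Filter.eventually_all_finset]
    intro i _
    have ht : Tendsto (fun s : ℝ => (m + i : ℤ) * α + s) (𝓝[≥] 0) (𝓝[≥] ((m + i : ℤ) * α)) := by
      refine tendsto_nhdsWithin_iff.2 ⟨?_, ?_⟩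
      · refine (Continuous.tendsto' (by fun_prop) _ _ (by simp)).mono_left nhdsWithin_le_nhds
      · filter_upwards [self_mem_nhdsWithin] with s hs
        simpa using hs
    exact ht.eventually (hright _)
  obtain ⟨ε, hε, hev⟩ := (mem_nhdsGE_iff_exists_Ico_subset).1 hev
  replace hε : 0 < ε := hε
  have hpat (k : ℤ) (h : ∃ a : ℤ, (k * α + a : ℝ) ∈ Ioo (m * α) (m * α + ε)) :
      ∀ i < n, G ((k + i : ℤ) * α) = G ((m + i : ℤ) * α) := by
    intro i hi
    obtain ⟨a, h₁, h₂⟩ := h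
    have := hev (show (k * α + a - m * α : ℝ) ∈ Ico 0 ε from ⟨by linarith, by linarith⟩) i
      (Finset.mem_range.2 hi)
    rw [← this, ← hper _ a]
    congr 1
    push_cast
    ring
  -- The orbit of `u` meets the block's interval after `q + 1` steps forward and `p` steps backward.
  -- Using `q + 1` keeps the passage through `u` (the term `i = p`) strictly before the second
  -- occurrence.
  obtain ⟨a, q, hq⟩ := exists_nat_int_add_mul_mem_Ioo hα
    (show m * α - u - α < m * α + ε - u - α by linarith)
  obtain ⟨a', p, hp⟩ := exists_nat_int_sub_mul_mem_Ioo hα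
    (show m * α - u < m * α + ε - u by linarith)
  have hnear : ∀ᶠ y in 𝓝 u, y - p * α + a' ∈ Ioo (m * α) (m * α + ε) ∧
      y + (q + 1) * α + a ∈ Ioo (m * α) (m * α + ε) ∧
      ∀ i ∈ Finset.range (p + (q + 1)), i ≠ p →
        G (y + ((i : ℤ) - p : ℤ) * α) = G (u + ((i : ℤ) - p : ℤ) * α) := by
    refine Filter.Eventually.and ?_ (Filter.Eventually.and ?_ ?_)
    · refine (show Continuous fun y : ℝ => y - p * α + a' by fun_prop).continuousAt.eventually_mem
        (Ioo_mem_nhds ?_ ?_) <;> linarith [hp.1, hp.2]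
    · refine (show Continuous fun y : ℝ => y + (q + 1) * α + a by
        fun_prop).continuousAt.eventually_mem (Ioo_mem_nhds ?_ ?_) <;> linarith [hq.1, hq.2]
    · rw [Filter.eventually_all_finset]
      intro i _
      by_cases hi : i = p
      · simp [hi]
      · have := (show Continuous fun y : ℝ => y + ((i : ℤ) - p : ℤ) * α by
          fun_prop).continuousAt.eventually (horbit ((i : ℤ) - p : ℤ) (by omega))
        filter_upwards [this] with y hy _ using hy
  -- Between the two occurrences the sum is zero, and all terms but the one near `u` are locally
  -- constant. So `G` takes one and the same value at all orbit points close to `u`, on either side,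
  -- which contradicts the jump.
  have hsum (k b : ℤ) (h : b + k * α - p * α + a' ∈ Ioo (m * α) (m * α + ε) ∧
      b + k * α + (q + 1) * α + a ∈ Ioo (m * α) (m * α + ε) ∧
      ∀ i ∈ Finset.range (p + (q + 1)), i ≠ p →
        G (b + k * α + ((i : ℤ) - p : ℤ) * α) = G (u + ((i : ℤ) - p : ℤ) * α)) :
      G (b + k * α) + ∑ i ∈ (Finset.range (p + (q + 1))).erase p,
        G (u + ((i : ℤ) - p : ℤ) * α) = 0 := by
    obtain ⟨h₁, h₂, h₃⟩ := h
    have h₀ := hmn (k - p) (p + (q + 1))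
      (hpat _ ⟨b + a', by
        convert h₁ using 1
        push_cast
        ring⟩)
      (hpat _ ⟨b + a, by
        convert h₂ using 1
        push_cast
        ring⟩)
    rw [← Finset.add_sum_erase _ _ (show p ∈ Finset.range (p + (q + 1)) by simp)] at h₀
    rw [← h₀]
    congr 1
    · rw [← hper ((k - p + p : ℤ) * α) b]
      congr 1
      push_cast
      ring
    · refine Finset.sum_congr rfl fun i hi => ?_
      rw [Finset.mem_erase] at hi
      rw [← h₃ i hi.2 hi.1, ← hper ((k - p + i : ℤ) * α) b]
      congr 1
      push_cast
      ring
  obtain ⟨b, k, hbk, hG⟩ := exists_int_add_mul_of_eventually_gt hα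
    ((hnear.filter_mono nhdsWithin_le_nhds).and
      ((hright u).filter_mono (nhdsWithin_mono _ Ioi_subset_Ici_self)))
  obtain ⟨b', k', hbk', hG'⟩ := exists_int_add_mul_of_eventually_lt hα
    ((hnear.filter_mono nhdsWithin_le_nhds).and hjump)
  have := hsum k b hbk
  have := hsum k' b' hbk'
  omega

/-! ### Visits to two arcs of equal length -/

/-- The indicator function of the arc `[0, c)` of the circle. -/
noncomputable def arc (c x : ℝ) : ℤ := if Int.fract x < c then 1 else 0

theorem arc_add_int (c x : ℝ) (a : ℤ) : arc c (x + a) = arc c x := by simp [arc]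

theorem arc_eventually_ge (c x : ℝ) : ∀ᶠ y in 𝓝[≥] x, arc c y = arc c x := by
  have h : ∀ᶠ y : ℝ in 𝓝[≥] x, y < ⌊x⌋ + 1 :=
    nhdsWithin_le_nhds (Iio_mem_nhds (Int.lt_floor_add_one x))
  have h' : ∀ᶠ y : ℝ in 𝓝[≥] x, Int.fract x < c → y < ⌊x⌋ + c := by
    by_cases hx : Int.fract x < c
    · filter_upwards [nhdsWithin_le_nhds
        (Iio_mem_nhds (show x < ⌊x⌋ + c by linarith [Int.self_sub_floor x]))] with y hy _ using hy
    · simp [hx]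
  filter_upwards [h, h', self_mem_nhdsWithin] with y h₁ h₂ h₃
  have h₃ : x ≤ y := h₃
  have hf : ⌊y⌋ = ⌊x⌋ := Int.floor_eq_iff.2 ⟨(Int.floor_le x).trans h₃, h₁⟩
  have : Int.fract y < c ↔ Int.fract x < c := by
    constructor <;> intro h <;> simp only [Int.fract, hf] at *
    · linarith
    · linarith [h₂ h]
  simp [arc, this]

theorem arc_eventually_eq {c x : ℝ} (hx : ∀ a : ℤ, x ≠ a) (hxc : ∀ a : ℤ, x ≠ a + c) :
    ∀ᶠ y in 𝓝 x, arc c y = arc c x := by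
  have hlt : (⌊x⌋ : ℝ) < x := lt_of_le_of_ne (Int.floor_le x) (hx _).symm
  have h' : ∀ᶠ y : ℝ in 𝓝 x, y < ⌊x⌋ + c ↔ x < ⌊x⌋ + c := by
    rcases lt_or_gt_of_ne (hxc ⌊x⌋) with h | h
    · filter_upwards [Iio_mem_nhds h] with y hy
      exact ⟨fun _ => h, fun _ => hy⟩
    · filter_upwards [Ioi_mem_nhds h] with y hy
      exact ⟨fun h' => absurd h' (not_lt.2 (le_of_lt hy)), fun h' => absurd h' (not_lt.2 h.le)⟩
  filter_upwards [h', Ioo_mem_nhds hlt (Int.lt_floor_add_one x)] with y h₂ h₃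
  have hf : ⌊y⌋ = ⌊x⌋ := Int.floor_eq_iff.2 ⟨h₃.1.le, h₃.2⟩
  have : Int.fract y < c ↔ Int.fract x < c := by
    simp only [Int.fract, hf, sub_lt_iff_lt_add']
    exact h₂
  simp [arc, this]

theorem arc_zero {c : ℝ} (hc : 0 < c) : arc c 0 = 1 := by simp [arc, hc]

theorem arc_eventually_lt_zero {c : ℝ} (hc : c < 1) : ∀ᶠ y in 𝓝[<] (0 : ℝ), arc c y = 0 := by
  filter_upwards [Ioo_mem_nhdsLT (show max (-1) (c - 1) < 0 by simpa using hc)] with y hy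
  have h₁ := (max_lt_iff.1 hy.1)
  have hf : ⌊y⌋ = -1 := Int.floor_eq_iff.2 ⟨by push_cast; linarith, by push_cast; linarith [hy.2]⟩
  have : ¬ Int.fract y < c := by
    simp only [Int.fract, hf]
    push_cast
    linarith
  simp [arc, this]

/-- The visits of the orbit of `0` under an irrational rotation to the arcs `[u, u + c)` and
`[v, v + c)` have unbounded difference if the endpoints of the arcs lie on different orbits
from `u`. -/
theorem arc_sums_unbounded {α c u v : ℝ} (hα : Irrational α) (hc₀ : 0 < c) (hc₁ : c < 1)
    (hc : ∀ a b : ℤ, (a + b * α : ℝ) ≠ c) (hv : ∀ a b : ℤ, (a + b * α : ℝ) ≠ v - u)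
    (hvc : ∀ a b : ℤ, (a + b * α : ℝ) ≠ v + c - u) (K : ℤ) :
    ¬ ∀ (m : ℤ) (n : ℕ), |∑ i ∈ Finset.range n,
      (arc c ((m + i : ℤ) * α - u) - arc c ((m + i : ℤ) * α - v))| ≤ K := by
  have hcont (w x : ℝ) : Tendsto (fun y : ℝ => y - w) (𝓝 x) (𝓝 (x - w)) :=
    (show Continuous fun y : ℝ => y - w by fun_prop).tendsto x
  have hV (j : ℤ) : ∀ᶠ y in 𝓝 (u + j * α), arc c (y - v) = arc c (u + j * α - v) := by
    refine (hcont v _).eventually (arc_eventually_eq (fun a h => ?_) (fun a h => ?_))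
    · exact hv (-a) j (by push_cast; linarith)
    · exact hvc (-a) j (by push_cast; linarith)
  -- The jumps of this function lie at `u`, `u + c`, `v` and `v + c` modulo `1`; the hypotheses keep
  -- the last three off the orbit of `u`.
  refine birkhoff_sums_unbounded (G := fun x => arc c (x - u) - arc c (x - v)) (u := u) hα ?_ ?_ ?_
    ?_ K
  · intro x a
    rw [add_sub_right_comm, arc_add_int, add_sub_right_comm, arc_add_int]
  · intro x
    have h (w : ℝ) : Tendsto (fun y : ℝ => y - w) (𝓝[≥] x) (𝓝[≥] (x - w)) :=
      tendsto_nhdsWithin_iff.2 ⟨(hcont w x).mono_left nhdsWithin_le_nhds, by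
        filter_upwards [self_mem_nhdsWithin] with y hy
        exact sub_le_sub_right hy w⟩
    filter_upwards [(h u).eventually (arc_eventually_ge c _),
      (h v).eventually (arc_eventually_ge c _)] with y h₁ h₂
    rw [h₁, h₂]
  · have h : Tendsto (fun y : ℝ => y - u) (𝓝[<] u) (𝓝[<] 0) :=
      tendsto_nhdsWithin_iff.2 ⟨by simpa using (hcont u u).mono_left nhdsWithin_le_nhds, by
        filter_upwards [self_mem_nhdsWithin] with y hy
        exact mem_Iio.2 (sub_neg.2 (mem_Iio.1 hy))⟩
    have hV₀ := hV 0
    simp only [Int.cast_zero, zero_mul, add_zero] at hV₀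
    filter_upwards [h.eventually (arc_eventually_lt_zero hc₁),
      hV₀.filter_mono nhdsWithin_le_nhds] with y h₁ h₂
    rw [h₁, h₂, sub_self, arc_zero hc₀]
    ring
  · intro j hj
    have hU : ∀ᶠ y in 𝓝 (u + j * α), arc c (y - u) = arc c (u + j * α - u) := by
      refine (hcont u _).eventually (arc_eventually_eq (fun a h => ?_) (fun a h => ?_))
      · have h' : (j * α : ℝ) = a := by linarith
        exact (hα.intCast_mul hj).ne_int a h'
      · exact hc (-a) j (by push_cast; linarith)
    filter_upwards [hU, hV j] with y h₁ h₂
    rw [h₁, h₂]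

/-! ### From bounded displacement to bounded differences of counts -/

open Real in
/-- A half-open window of length at most one contains at most one point `a + b ψ` for each `b`,
and `a` is then determined by `b`. -/
theorem mem_fibonacciCutAndProject_Ico {c u x : ℝ} (hc : c ≤ 1) :
    x ∈ fibonacciCutAndProject (Ico u (u + c)) ↔
      ∃ b : ℤ, arc c (b * goldenConj - u) = 1 ∧
        x = b * goldenRatio - ⌊b * goldenConj - u⌋ := by
  constructor
  · rintro ⟨a, b, rfl, h₁, h₂⟩
    have hf : ⌊b * goldenConj - u⌋ = -a :=
      Int.floor_eq_iff.2 ⟨by push_cast; linarith, by push_cast; linarith⟩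
    refine ⟨b, ?_, by rw [hf]; push_cast; ring⟩
    have : Int.fract (b * goldenConj - u) < c := by
      rw [Int.fract, hf]
      push_cast
      linarith
    simp [arc, this]
  · rintro ⟨b, hb, rfl⟩
    have h : Int.fract (b * goldenConj - u) < c := by
      by_contra h
      simp [arc, h] at hb
    refine ⟨-⌊b * goldenConj - u⌋, b, by push_cast; ring, ?_⟩
    have h₀ := Int.fract_nonneg (b * goldenConj - u)
    rw [Int.fract] at h h₀
    push_cast
    exact ⟨by linarith, by linarith⟩

theorem int_add_mul_inj {α : ℝ} (hα : Irrational α) {a b a' b' : ℤ}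
    (h : (a + b * α : ℝ) = a' + b' * α) : a = a' ∧ b = b' := by
  have hb : b = b' := by
    by_contra hne
    have h' : ((b - b' : ℤ) * α : ℝ) = (a' - a : ℤ) := by push_cast; linarith
    exact (hα.intCast_mul (sub_ne_zero.2 hne)).ne_int _ h'
  subst hb
  exact ⟨by exact_mod_cast add_right_cancel h, rfl⟩

open Real in
/-- A bounded displacement between two cut-and-project sets gives a bounded displacement between
the sets of indices of their points. -/
theorem BDEquiv.exists_int_displacement {c u v : ℝ} (hc : c ≤ 1)
    (h : BDEquiv (fibonacciCutAndProject (Ico u (u + c)))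
      (fibonacciCutAndProject (Ico v (v + c)))) :
    ∃ (K : ℕ) (g : ℤ → ℤ), ∀ b : ℤ, arc c (b * goldenConj - u) = 1 →
      arc c (g b * goldenConj - v) = 1 ∧ |g b - b| ≤ K ∧
        ∀ b' : ℤ, arc c (b' * goldenConj - u) = 1 → g b = g b' → b = b' := by
  obtain ⟨f, C, hf⟩ := h
  have hex (b : ℤ) (hb : arc c (b * goldenConj - u) = 1) :=
    (mem_fibonacciCutAndProject_Ico hc).1
      (f ⟨_, (mem_fibonacciCutAndProject_Ico hc).2 ⟨b, hb, rfl⟩⟩).2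
  choose! g hg hfg using hex
  -- The point of index `b` is `b(φ - ψ) + u` plus a fractional part, so each of the two points
  -- contributes its window position and at most `1`. Division by `φ - ψ ≥ 1` does not enlarge the
  -- bound.
  refine ⟨⌈C + |u| + |v| + 2⌉₊, g, fun b hb => ⟨hg b hb, ?_, fun b' hb' hbb' => ?_⟩⟩
  · have h₁ := abs_le.1 (hf ⟨_, (mem_fibonacciCutAndProject_Ico hc).2 ⟨b, hb, rfl⟩⟩)
    rw [hfg b hb] at h₁
    simp only at h₁
    have h₂ := Int.floor_le (b * goldenConj - u)
    have h₃ := Int.lt_floor_add_one (b * goldenConj - u)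
    have h₄ := Int.floor_le (g b * goldenConj - v)
    have h₅ := Int.lt_floor_add_one (g b * goldenConj - v)
    have h₆ := Nat.le_ceil (C + |u| + |v| + 2)
    have h₇ := abs_le.1 (le_refl |u|)
    have h₈ := abs_le.1 (le_refl |v|)
    have h₉ : |(g b - b : ℝ) * (goldenRatio - goldenConj)| ≤ C + |u| + |v| + 2 :=
      abs_le.2 ⟨by linarith, by linarith⟩
    rw [abs_mul] at h₉
    have h₁₀ : 1 ≤ |goldenRatio - goldenConj| := by
      rw [le_abs]
      left
      linarith [one_lt_goldenRatio, goldenConj_neg]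
    have h₁₁ : |(g b - b : ℝ)| ≤ ⌈C + |u| + |v| + 2⌉₊ :=
      ((le_mul_of_one_le_right (abs_nonneg _) h₁₀).trans h₉).trans h₆
    exact_mod_cast h₁₁
  · have h₁ := hfg b hb
    rw [hbb', ← hfg b' hb'] at h₁
    have h₂ := congrArg Subtype.val (f.injective (Subtype.ext h₁))
    simp only at h₂
    refine (int_add_mul_inj goldenRatio_irrational (a := -⌊b * goldenConj - u⌋)
      (a' := -⌊b' * goldenConj - u⌋) ?_).2
    push_cast
    linarith

theorem sum_arc_eq_card (c α u : ℝ) (m : ℤ) (n : ℕ) :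
    ∑ i ∈ Finset.range n, arc c ((m + i : ℤ) * α - u) =
      ((Finset.Ico m (m + n)).filter fun b : ℤ => arc c (b * α - u) = 1).card := by
  have h : Finset.Ico m (m + n) = (Finset.range n).image fun i : ℕ => m + i := by
    ext b
    simp only [Finset.mem_Ico, Finset.mem_image, Finset.mem_range]
    exact ⟨fun h => ⟨(b - m).toNat, by omega, by omega⟩, by rintro ⟨i, hi, rfl⟩; omega⟩
  rw [Finset.card_filter, h, Finset.sum_image (fun i _ j _ hij => by simpa using hij)]
  push_cast
  refine Finset.sum_congr rfl fun i _ => ?_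
  unfold arc
  split_ifs <;> simp_all

/-- An injection that moves the visits to one arc by a bounded amount into the visits to another
arc bounds the number of visits to the first arc in terms of that to the second. -/
theorem sum_arc_le_of_displacement {c α u v : ℝ} {K : ℕ} {g : ℤ → ℤ}
    (hg : ∀ b : ℤ, arc c (b * α - u) = 1 → arc c (g b * α - v) = 1 ∧ |g b - b| ≤ K ∧
      ∀ b' : ℤ, arc c (b' * α - u) = 1 → g b = g b' → b = b') (m : ℤ) (n : ℕ) :
    ∑ i ∈ Finset.range n, arc c ((m + i : ℤ) * α - u) ≤
      ∑ i ∈ Finset.range n, arc c ((m + i : ℤ) * α - v) + 2 * K := by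
  rw [sum_arc_eq_card, sum_arc_eq_card]
  -- Images of indices in the block stay in it or land in one of two margins of length `K`, which
  -- gives the error `2 * K`.
  have h : ((Finset.Ico m (m + n)).filter fun b : ℤ => arc c (b * α - u) = 1).card ≤
      (((Finset.Ico m (m + n)).filter fun b : ℤ => arc c (b * α - v) = 1) ∪
        (Finset.Ico (m - K) m ∪ Finset.Ico (m + n) (m + n + K))).card := by
    refine Finset.card_le_card_of_injOn g (fun b hb => ?_) (fun b hb b' hb' h => ?_)
    · simp only [Finset.coe_filter, mem_ofPred_eq, Finset.mem_Ico] at hb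
      obtain ⟨h₁, h₂, -⟩ := hg b hb.2
      rw [abs_le] at h₂
      simp only [Finset.coe_union, Finset.coe_filter, Finset.coe_Ico, mem_union, mem_ofPred_eq,
        Finset.mem_Ico, mem_Ico]
      omega
    · simp only [Finset.coe_filter, mem_ofPred_eq] at hb hb'
      exact (hg b hb.2).2.2 b' hb'.2 h
  have h₁ := h.trans ((Finset.card_union_le _ _).trans
    (Nat.add_le_add_left (Finset.card_union_le _ _) _))
  simp only [Int.card_Ico] at h₁
  omega

open Real in
/-- If two cut-and-project sets with half-open windows of equal length are BD-equivalent, then the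
counts of their points differ by a bounded amount. -/
theorem BDEquiv.sum_arc_bounded {c u v : ℝ} (hc : c ≤ 1)
    (h : BDEquiv (fibonacciCutAndProject (Ico u (u + c)))
      (fibonacciCutAndProject (Ico v (v + c)))) :
    ∃ K : ℤ, ∀ (m : ℤ) (n : ℕ), |∑ i ∈ Finset.range n,
      (arc c ((m + i : ℤ) * goldenConj - u) - arc c ((m + i : ℤ) * goldenConj - v))| ≤ K := by
  obtain ⟨K, g, hg⟩ := h.exists_int_displacement hc
  obtain ⟨K', g', hg'⟩ := h.symm.exists_int_displacement hc
  refine ⟨2 * K + 2 * K', fun m n => ?_⟩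
  have h₁ := sum_arc_le_of_displacement hg m n
  have h₂ := sum_arc_le_of_displacement hg' m n
  rw [Finset.sum_sub_distrib, abs_le]
  omega

/-! ### Counting BD-classes -/

open Real in
theorem goldenRatio_half_lt_one : goldenRatio / 2 < 1 := by linarith [goldenRatio_lt_two]

-- Parity: doubling would make the coefficient `1` of `φ = 1 - ψ` even. This keeps the two ends of
-- an arc on different orbits, and is also what lets endpoints be treated separately in
-- `IsHalfFibonacci.patches`.
open Real in
theorem int_add_mul_goldenConj_ne_half (a b : ℤ) : (a + b * goldenConj : ℝ) ≠ goldenRatio / 2 := by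
  intro h
  have h' : ((2 * a : ℤ) + (2 * b : ℤ) * goldenConj : ℝ) = (1 : ℤ) + (-1 : ℤ) * goldenConj := by
    push_cast
    linarith [one_sub_goldenRatio]
  have := (int_add_mul_inj goldenConj_irrational h').1
  omega

/-- The half-Fibonacci set with the window `[u, u + φ / 2)`. -/
def halfFibonacci (u : ℝ) : Set ℝ := fibonacciCutAndProject (Ico u (u + Real.goldenRatio / 2))

open Real in
/-- If two half-Fibonacci sets are BD-equivalent, then the positions of their windows differ by an
element of a fixed countable set. -/
theorem BDEquiv.exists_int_halfFibonacci {u v : ℝ}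
    (h : BDEquiv (halfFibonacci u) (halfFibonacci v)) :
    ∃ a b : ℤ, v = u + (a + b * goldenConj) ∨ v = u + (a + b * goldenConj) - goldenRatio / 2 := by
  by_contra! hne
  obtain ⟨K, hK⟩ := h.sum_arc_bounded goldenRatio_half_lt_one.le
  refine arc_sums_unbounded goldenConj_irrational (half_pos goldenRatio_pos)
    goldenRatio_half_lt_one int_add_mul_goldenConj_ne_half (fun a b h => (hne a b).1 ?_)
    (fun a b h => (hne a b).2 ?_) K hK <;> linarith

open Real in
theorem countable_setOf_bdEquiv_halfFibonacci (u : ℝ) :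
    {v | BDEquiv (halfFibonacci u) (halfFibonacci v)}.Countable := by
  refine ((countable_range fun p : ℤ × ℤ => u + (p.1 + p.2 * goldenConj)).union
    (countable_range fun p : ℤ × ℤ => u + (p.1 + p.2 * goldenConj) - goldenRatio / 2)).mono ?_
  intro v hv
  obtain ⟨a, b, h | h⟩ := hv.exists_int_halfFibonacci
  · exact Or.inl ⟨(a, b), h.symm⟩
  · exact Or.inr ⟨(a, b), h.symm⟩

open Cardinal in
/-- A family of sets that contains all half-Fibonacci sets with half-open windows represents at
least continuum many BD-classes. -/
theorem continuum_le_bdCard {X : Set (Set ℝ)} (hX : ∀ u, halfFibonacci u ∈ X) : 𝔠 ≤ bdCard X := by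
  -- The map from window positions to classes has countable fibres, so `𝔠 ≤ bdCard X * ℵ₀`, which
  -- forces `𝔠 ≤ bdCard X`.
  have h := mk_le_mk_mul_of_mk_preimage_le (c := ℵ₀)
    (fun u : ℝ => (Quotient.mk (bdSetoid X) ⟨halfFibonacci u, hX u⟩)) (fun q => by
      rcases (((fun u : ℝ => (Quotient.mk (bdSetoid X) ⟨halfFibonacci u, hX u⟩)) ⁻¹'
        {q}).eq_empty_or_nonempty) with h | ⟨u, rfl⟩
      · simp [h]
      · refine le_aleph0_iff_set_countable.2
          ((countable_setOf_bdEquiv_halfFibonacci u).mono fun v hv => ?_)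
        exact (Quotient.exact hv).symm)
  rw [mk_real] at h
  by_contra! hlt
  exact absurd h (not_le.2 (mul_lt_of_lt aleph0_le_continuum hlt aleph0_lt_continuum))

-- Closed sets are Borel, and a countably generated σ-algebra has at most continuum many members.
open Cardinal in
theorem bdCard_le_continuum {X : Set (Set ℝ)} (hX : ∀ Γ ∈ X, IsClosed Γ) : bdCard X ≤ 𝔠 := by
  refine mk_quotient_le.trans ?_
  have h := MeasurableSpace.cardinal_measurableSet_le_continuum
    (s := MeasurableSpace.countableGeneratingSet ℝ)
    ((le_aleph0_iff_set_countable.2 MeasurableSpace.countable_countableGeneratingSet).trans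
      aleph0_le_continuum)
  rw [MeasurableSpace.generateFrom_countableGeneratingSet] at h
  exact (mk_le_mk_of_subset fun Γ hΓ => (hX Γ hΓ).measurableSet).trans h

/-! ### The hull in terms of approximate agreement on large balls -/

/-- Every point of `A` in the ball of radius `1 / ε` about `0` has distance less than `ε` from a
point of `B`. -/
def Near (ε : ℝ) (A B : Set ℝ) : Prop := ∀ x ∈ A, |x| < 1 / ε → ∃ y ∈ B, |x - y| < ε

theorem Near.mono {ε δ : ℝ} {A B : Set ℝ} (hε : 0 < ε) (h : ε ≤ δ) (hAB : Near ε A B) :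
    Near δ A B := fun x hx hxδ =>
  let ⟨y, hy, hxy⟩ := hAB x hx (hxδ.trans_le (one_div_le_one_div_of_le hε h))
  ⟨y, hy, hxy.trans_le h⟩

theorem bddBelow_chabautyFell (A B : Set ℝ) : BddBelow ({ε : ℝ | 0 < ε ∧
      A ∩ Metric.ball 0 (1 / ε) ⊆ Metric.cthickening ε B ∧
      B ∩ Metric.ball 0 (1 / ε) ⊆ Metric.cthickening ε A} ∪ {1}) := by
  refine ⟨0, ?_⟩
  rintro ε (h | rfl)
  · exact h.1.le
  · exact zero_le_one

theorem near_of_subset_cthickening {ε δ : ℝ} {A B : Set ℝ} (hε : 0 < ε) (hδ : ε < δ)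
    (h : A ∩ Metric.ball 0 (1 / ε) ⊆ Metric.cthickening ε B) : Near δ A B := by
  intro x hx hxδ
  have hx' : x ∈ Metric.thickening δ B :=
    Metric.cthickening_subset_thickening' (hε.trans hδ) hδ B (h ⟨hx, by
      rw [mem_ball_zero_iff, Real.norm_eq_abs]
      exact hxδ.trans_le (one_div_le_one_div_of_le hε hδ.le)⟩)
  exact Metric.mem_thickening_iff.1 hx'

theorem near_of_chabautyFellDist_lt {ε : ℝ} {A B : Set ℝ} (hε : ε ≤ 1)
    (h : chabautyFellDist A B < ε) : Near ε A B ∧ Near ε B A := by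
  obtain ⟨δ, hδ | hδ, hδε⟩ := exists_lt_of_csInf_lt (by simp) h
  · exact ⟨near_of_subset_cthickening hδ.1 hδε hδ.2.1,
      near_of_subset_cthickening hδ.1 hδε hδ.2.2⟩
  · rw [mem_singleton_iff.1 hδ] at hδε
    exact absurd hδε (not_lt.2 hε)

theorem Near.subset_cthickening {ε : ℝ} {A B : Set ℝ} (h : Near ε A B) :
    A ∩ Metric.ball 0 (1 / ε) ⊆ Metric.cthickening ε B := by
  rintro x ⟨hx, hxε⟩
  rw [mem_ball_zero_iff, Real.norm_eq_abs] at hxε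
  obtain ⟨y, hy, hxy⟩ := h x hx hxε
  exact Metric.mem_cthickening_of_dist_le x y ε B hy hxy.le

theorem chabautyFellDist_le {ε : ℝ} {A B : Set ℝ} (hε : 0 < ε) (h : Near ε A B)
    (h' : Near ε B A) : chabautyFellDist A B ≤ ε :=
  csInf_le (bddBelow_chabautyFell A B) (Or.inl ⟨hε, h.subset_cthickening, h'.subset_cthickening⟩)

theorem mem_hull_iff {Λ Γ : Set ℝ} : Γ ∈ hull Λ ↔ IsClosed Γ ∧ ∀ ε : ℝ, 0 < ε →
    ∃ t : ℝ, Near ε Γ (translate Λ t) ∧ Near ε (translate Λ t) Γ := by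
  refine and_congr_right fun _ => ⟨fun h ε hε => ?_, fun h ε hε => ?_⟩
  -- The cap at `1` excludes the default element `1` of the set whose infimum is the distance.
  · obtain ⟨t, ht⟩ := h (min ε 1) (by positivity)
    obtain ⟨h₁, h₂⟩ := near_of_chabautyFellDist_lt (min_le_right _ _) ht
    exact ⟨t, h₁.mono (by positivity) (min_le_left _ _),
      h₂.mono (by positivity) (min_le_left _ _)⟩
  · obtain ⟨t, h₁, h₂⟩ := h (ε / 2) (half_pos hε)
    exact ⟨t, (chabautyFellDist_le (half_pos hε) h₁ h₂).trans_lt (half_lt_self hε)⟩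

theorem mem_translate {Λ : Set ℝ} {t x : ℝ} : x ∈ translate Λ t ↔ x + t ∈ Λ := by
  constructor
  · rintro ⟨y, hy, rfl⟩
    simpa using hy
  · exact fun h => ⟨x + t, h, by simp⟩

theorem mem_hull_self {Λ : Set ℝ} (h : IsClosed Λ) : Λ ∈ hull Λ := by
  refine mem_hull_iff.2 ⟨h, fun ε hε => ⟨0, ?_⟩⟩
  have h₀ : translate Λ 0 = Λ := by
    ext
    simp [mem_translate]
  rw [h₀]
  have : Near ε Λ Λ := fun x hx _ => ⟨x, hx, by simpa using hε⟩
  exact ⟨this, this⟩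

/-- If every patch of `Λ'` occurs in `Λ`, then the hull of `Λ'` is contained in that of `Λ`. -/
theorem hull_subset_of_patches {Λ Λ' : Set ℝ}
    (h : ∀ R : ℝ, ∃ τ : ℝ, ∀ x, |x| ≤ R → (x ∈ Λ' ↔ x ∈ translate Λ τ)) : hull Λ' ⊆ hull Λ := by
  intro Γ hΓ
  rw [mem_hull_iff] at hΓ ⊢
  refine ⟨hΓ.1, fun ε hε => ?_⟩
  obtain ⟨t, h₁, h₂⟩ := hΓ.2 ε hε
  -- Partners of points in the ball of radius `1 / ε` reach out to `1 / ε + ε`, and undoing the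
  -- translation by `t` adds `|t|`.
  obtain ⟨τ, hτ⟩ := h (|t| + 1 / ε + ε)
  have hagree (y : ℝ) (hy : |y| ≤ 1 / ε + ε) :
      y ∈ translate Λ' t ↔ y ∈ translate Λ (t + τ) := by
    rw [mem_translate, mem_translate, hτ _ ((abs_add_le y t).trans (by linarith)), mem_translate,
      add_assoc]
  refine ⟨t + τ, fun x hx hxε => ?_, fun x hx hxε => ?_⟩
  · obtain ⟨y, hy, hxy⟩ := h₁ x hx hxε
    refine ⟨y, (hagree y ?_).1 hy, hxy⟩
    have := abs_sub_abs_le_abs_sub y x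
    rw [abs_sub_comm y x] at this
    linarith
  · exact h₂ x ((hagree x (by linarith)).2 hx) hxε

/-! ### The Delone property -/

/-- Separation and relative density, with explicit constants, in the form in which they pass to
the elements of the hull. -/
theorem isDelone_of_mem_hull {Λ Γ : Set ℝ} {r R : ℝ} (hr : 0 < r)
    (hsep : Λ.Pairwise fun x y => r ≤ |x - y|) (hdense : ∀ t : ℝ, ∃ x ∈ Λ, |t - x| ≤ R)
    (hΓ : Γ ∈ hull Λ) : IsDelone Γ := by
  rw [mem_hull_iff] at hΓ
  have hR : 0 ≤ R := by
    obtain ⟨x, -, hx⟩ := hdense 0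
    exact (abs_nonneg _).trans hx
  have hsepΓ : Metric.IsSeparated (r / 4).toNNReal Γ := by
    intro x hx y hy hxy
    suffices h : r / 2 ≤ |x - y| by
      rw [edist_dist, Real.dist_eq]
      exact (ENNReal.ofReal_lt_ofReal_iff (by linarith)).2 (by linarith)
    have hxy' : 0 < |x - y| := abs_pos.2 (sub_ne_zero.2 hxy)
    -- The three bounds put `x` and `y` inside the ball, limit the loss of separation to `2ε ≤ r /
    -- 2`, and make the approximating points distinct.
    obtain ⟨ε, hε, hεx, hεr, hεxy⟩ : ∃ ε : ℝ, 0 < ε ∧ ε ≤ 1 / (|x| + |y| + 1) ∧ ε ≤ r / 4 ∧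
        ε ≤ |x - y| / 2 :=
      ⟨min (1 / (|x| + |y| + 1)) (min (r / 4) (|x - y| / 2)), by positivity, min_le_left _ _,
        (min_le_right _ _).trans (min_le_left _ _), (min_le_right _ _).trans (min_le_right _ _)⟩
    have hb : |x| + |y| + 1 ≤ 1 / ε := (le_one_div hε (by positivity)).1 hεx
    obtain ⟨t, h, -⟩ := hΓ.2 ε hε
    obtain ⟨x', hx', hxx⟩ := h x hx (by linarith [abs_nonneg y])
    obtain ⟨y', hy', hyy⟩ := h y hy (by linarith [abs_nonneg x])
    rw [mem_translate] at hx' hy'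
    have hne : x' + t ≠ y' + t := by
      intro he
      rw [add_right_cancel he] at hxx
      have := abs_sub_le x y' y
      rw [abs_sub_comm y' y] at this
      linarith
    have h₁ : r ≤ |x' + t - (y' + t)| := hsep hx' hy' hne
    rw [add_sub_add_right_eq_sub] at h₁
    have h₂ := abs_sub_le x' x y'
    have h₃ := abs_sub_le x y y'
    rw [abs_sub_comm x' x] at h₂
    linarith
  have hcover : Metric.IsCover (R + 1).toNNReal univ Γ := by
    intro p _
    obtain ⟨ε, hε, hεp, hε₁⟩ : ∃ ε : ℝ, 0 < ε ∧ ε ≤ 1 / (|p| + R + 1) ∧ ε ≤ 1 :=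
      ⟨min (1 / (|p| + R + 1)) 1, by positivity, min_le_left _ _, min_le_right _ _⟩
    have hb : |p| + R + 1 ≤ 1 / ε := (le_one_div hε (by positivity)).1 hεp
    obtain ⟨t, -, h⟩ := hΓ.2 ε hε
    obtain ⟨x, hx, hpx⟩ := hdense (p + t)
    have hpx' : |p - (x - t)| ≤ R := by rwa [sub_sub_eq_add_sub]
    have h₁ := abs_sub_abs_le_abs_sub (x - t) p
    rw [abs_sub_comm (x - t) p] at h₁
    obtain ⟨y, hy, hxy⟩ := h (x - t) (mem_translate.2 (by simpa using hx)) (by linarith)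
    refine ⟨y, hy, ?_⟩
    have h₂ := abs_sub_le p (x - t) y
    change edist p y ≤ _
    rw [edist_dist, Real.dist_eq]
    exact ENNReal.ofReal_le_ofReal (by linarith)
  exact ⟨⟨Γ, (r / 4).toNNReal, by simpa using hr, hsepΓ, (R + 1).toNNReal,
    by simpa using by linarith, hcover⟩, rfl⟩

-- The product is the absolute value of the norm `a² + ab - b²`, an integer that is nonzero by
-- irrationality.
open Real in
theorem abs_mul_conj_ge_one {a b : ℤ} (h : a ≠ 0 ∨ b ≠ 0) :
    1 ≤ |(a + b * goldenRatio : ℝ)| * |(a + b * goldenConj : ℝ)| := by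
  have hN : (a + b * goldenRatio : ℝ) * (a + b * goldenConj) = (a * a + a * b - b * b : ℤ) := by
    push_cast
    linear_combination (a * b : ℝ) * goldenRatio_add_goldenConj +
      (b * b : ℝ) * goldenRatio_mul_goldenConj
  have hne (α : ℝ) (hα : Irrational α) : (a + b * α : ℝ) ≠ 0 := by
    intro h₀
    have := int_add_mul_inj hα (a := a) (b := b) (a' := 0) (b' := 0) (by simpa using h₀)
    omega
  have h₀ := mul_ne_zero (hne _ goldenRatio_irrational) (hne _ goldenConj_irrational)
  rw [← abs_mul]
  rw [hN] at h₀ ⊢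
  exact_mod_cast Int.one_le_abs (by exact_mod_cast h₀)

-- The conjugate of a difference of two points is at most the window length `φ/2 < 1`, so the norm
-- bound forces the difference itself to be at least `1`.
open Real in
theorem IsHalfFibonacci.pairwise_one_le {Λ : Set ℝ} (h : IsHalfFibonacci Λ) :
    Λ.Pairwise fun x y => 1 ≤ |x - y| := by
  obtain ⟨s, W, -, hW, rfl⟩ := h
  rintro _ ⟨a, b, rfl, hab⟩ _ ⟨a', b', rfl, hab'⟩ hne
  have h₁ := hW hab
  have h₂ := hW hab'
  have h₃ : a - a' ≠ 0 ∨ b - b' ≠ 0 := by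
    by_contra! h
    rw [sub_eq_zero.1 h.1, sub_eq_zero.1 h.2] at hne
    exact hne rfl
  have h₄ := abs_mul_conj_ge_one h₃
  have h₅ : |((a - a' : ℤ) + (b - b' : ℤ) * goldenConj : ℝ)| ≤ 1 := by
    have := goldenRatio_half_lt_one
    push_cast
    exact abs_le.2 ⟨by linarith [h₁.1, h₂.2], by linarith [h₁.2, h₂.1]⟩
  have h₆ := h₄.trans (mul_le_of_le_one_right (abs_nonneg _) h₅)
  rwa [show ((a - a' : ℤ) + (b - b' : ℤ) * goldenRatio : ℝ) =
    a + b * goldenRatio - (a' + b' * goldenRatio) by push_cast; ring] at h₆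

open Real in
/-- Of two consecutive points of the orbit under the rotation by `ψ`, one visits the open arc. -/
theorem exists_mem_Ioo_window (s : ℝ) (b : ℤ) : ∃ (a b' : ℤ), |(b' - b : ℝ)| ≤ 1 ∧
    (a + b' * goldenConj : ℝ) ∈ Ioo s (s + goldenRatio / 2) := by
  have h₀ := Int.fract_nonneg (b * goldenConj - s)
  have h₁ := Int.fract_lt_one (b * goldenConj - s)
  have h₂ := one_sub_goldenRatio
  have hφ : 3 / 2 < goldenRatio := by
    by_contra! h
    nlinarith [goldenRatio_sq, goldenRatio_pos]
  have hφ' : goldenRatio < 5 / 3 := by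
    by_contra! h
    nlinarith [goldenRatio_sq, goldenRatio_pos]
  rw [Int.fract] at h₀ h₁
  by_cases h : (-⌊b * goldenConj - s⌋ + b * goldenConj : ℝ) ∈ Ioo s (s + goldenRatio / 2)
  · exact ⟨-⌊b * goldenConj - s⌋, b, by simp, by simpa using h⟩
  · rw [mem_Ioo, not_and_or, not_lt, not_lt] at h
    -- The representative in `[s, s + 1)` misses the open arc only at `s`, where adding `1 + ψ = 2 -
    -- φ` leads inside, or in `[s + φ/2, s + 1)`, where adding `ψ` does.
    rcases h with h | h
    · refine ⟨-⌊b * goldenConj - s⌋ + 1, b + 1, by simp, ?_⟩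
      push_cast
      exact ⟨by linarith, by linarith⟩
    · refine ⟨-⌊b * goldenConj - s⌋, b + 1, by simp, ?_⟩
      push_cast
      exact ⟨by linarith, by linarith⟩

open Real in
theorem IsHalfFibonacci.exists_abs_sub_le {Λ : Set ℝ} (h : IsHalfFibonacci Λ) :
    ∃ R : ℝ, ∀ t : ℝ, ∃ x ∈ Λ, |t - x| ≤ R := by
  obtain ⟨s, W, hW, -, rfl⟩ := h
  have hφ := goldenRatio_pos
  have hφ₂ := goldenRatio_lt_two
  have hψ := goldenConj_neg
  have hψ₁ := neg_one_lt_goldenConj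
  refine ⟨|s| + 10, fun t => ?_⟩
  set d := goldenRatio - goldenConj with hd
  have hd₀ : 0 < d := by linarith
  -- Since `a + bφ = (a + bψ) + bd` with the first summand in the window, an index `b` near `t / d`
  -- gives a point near `t`; the constant `10` is generous.
  obtain ⟨a, b, hb, hab⟩ := exists_mem_Ioo_window s ⌊t / d⌋
  refine ⟨a + b * goldenRatio, ⟨a, b, rfl, hW hab⟩, ?_⟩
  have h₁ : ⌊t / d⌋ * d ≤ t := (le_div_iff₀ hd₀).1 (Int.floor_le _)
  have h₂ : t < (⌊t / d⌋ + 1) * d := (div_lt_iff₀ hd₀).1 (Int.lt_floor_add_one _)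
  rw [abs_le] at hb
  have h₃ := mul_le_mul_of_nonneg_right hb.1 hd₀.le
  have h₄ := mul_le_mul_of_nonneg_right hb.2 hd₀.le
  have h₅ : (a + b * goldenRatio : ℝ) = a + b * goldenConj + b * d := by rw [hd]; ring
  have h₆ := abs_le.1 (le_refl |s|)
  rw [h₅]
  exact abs_le.2 ⟨by linarith [hab.2], by linarith [hab.1]⟩

theorem IsHalfFibonacci.isClosed {Λ : Set ℝ} (h : IsHalfFibonacci Λ) : IsClosed Λ :=
  Metric.isClosed_of_pairwise_le_dist one_pos h.pairwise_one_le

/-! ### Common patches and the common hull -/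

open Real in
/-- A bounded region of the plane contains finitely many lattice points. -/
theorem finite_lattice_points (R S : ℝ) :
    {p : ℤ × ℤ | |(p.1 + p.2 * goldenRatio : ℝ)| ≤ R ∧ |(p.1 + p.2 * goldenConj : ℝ)| ≤ S}.Finite := by
  obtain ⟨N, hN⟩ := exists_nat_ge (R + S)
  refine ((Set.finite_Icc (-(3 * N : ℤ)) (3 * N)).prod (Set.finite_Icc (-(N : ℤ)) N)).subset ?_
  rintro ⟨a, b⟩ ⟨h₁, h₂⟩
  simp only at h₁ h₂
  have hR : 0 ≤ R := (abs_nonneg _).trans h₁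
  have hS : 0 ≤ S := (abs_nonneg _).trans h₂
  have hb : |(b : ℝ)| ≤ N := by
    have h₃ : |b * (goldenRatio - goldenConj)| ≤ R + S := by
      have := abs_sub (a + b * goldenRatio : ℝ) (a + b * goldenConj)
      rw [show (b * (goldenRatio - goldenConj) : ℝ) =
        (a + b * goldenRatio) - (a + b * goldenConj) by ring]
      linarith
    rw [abs_mul] at h₃
    have h₄ : 1 ≤ |goldenRatio - goldenConj| := by
      rw [le_abs]
      left
      linarith [one_lt_goldenRatio, goldenConj_neg]
    exact ((le_mul_of_one_le_right (abs_nonneg _) h₄).trans h₃).trans hN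
  have ha : |(a : ℝ)| ≤ 3 * N := by
    have h₃ := abs_sub (a + b * goldenRatio : ℝ) (b * goldenRatio)
    rw [add_sub_cancel_right, abs_mul (b : ℝ), abs_of_pos goldenRatio_pos] at h₃
    nlinarith [goldenRatio_lt_two, goldenRatio_pos, abs_nonneg (b : ℝ)]
  have ha' : |a| ≤ 3 * N := by exact_mod_cast ha
  have hb' : |b| ≤ N := by exact_mod_cast hb
  exact ⟨abs_le.1 ha', abs_le.1 hb'⟩

open Real in
/-- If a window is shifted by almost `s' - s`, on the side that agrees with the status of the
endpoints, then the membership of a given point in the window does not change. -/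
theorem eventually_mem_window_iff {s s' y : ℝ} {W W' : Set ℝ}
    (hW : Ioo s (s + goldenRatio / 2) ⊆ W) (hW₂ : W ⊆ Icc s (s + goldenRatio / 2))
    (hW' : Ioo s' (s' + goldenRatio / 2) ⊆ W') (hW₂' : W' ⊆ Icc s' (s' + goldenRatio / 2))
    {l : Filter ℝ} (hl : l ≤ 𝓝[≠] (s - s'))
    (h₁ : y = s' → ∀ᶠ η in l, (y ∈ W' ↔ s - s' < η))
    (h₂ : y = s' + goldenRatio / 2 → ∀ᶠ η in l, (y ∈ W' ↔ η < s - s')) :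
    ∀ᶠ η in l, (y ∈ W' ↔ y + η ∈ W) := by
  have hφ := goldenRatio_pos
  have hadd : Tendsto (fun η => y + η) l (𝓝 (y + (s - s'))) :=
    ((continuous_const.add continuous_id).tendsto (s - s')).mono_left
      (hl.trans nhdsWithin_le_nhds)
  have hne : ∀ᶠ η in l, η ≠ s - s' := hl self_mem_nhdsWithin
  rcases lt_trichotomy y s' with h | h | h
  · filter_upwards [hadd.eventually (Iio_mem_nhds (show y + (s - s') < s by linarith))] with η hη
    exact iff_of_false (fun h' => absurd (hW₂' h').1 (not_le.2 h))
      (fun h' => absurd (hW₂ h').1 (not_le.2 hη))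
  · filter_upwards [h₁ h, hne, hadd.eventually
      (Iio_mem_nhds (show y + (s - s') < s + goldenRatio / 2 by linarith))] with η h₁ h₂ h₃
    have h₃ : y + η < s + goldenRatio / 2 := h₃
    by_cases hy : y ∈ W'
    · exact iff_of_true hy (hW ⟨by linarith [h₁.1 hy], h₃⟩)
    · exact iff_of_false hy fun h' => h₂ (le_antisymm (not_lt.1 (mt h₁.2 hy)) (by linarith [(hW₂ h').1]))
  · rcases lt_trichotomy y (s' + goldenRatio / 2) with h' | h' | h'
    · filter_upwards [hadd.eventually
        (Ioo_mem_nhds (show s < y + (s - s') by linarith)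
          (show y + (s - s') < s + goldenRatio / 2 by linarith))] with η hη
      exact iff_of_true (hW' ⟨h, h'⟩) (hW hη)
    · filter_upwards [h₂ h', hne, hadd.eventually
        (Ioi_mem_nhds (show s < y + (s - s') by linarith))] with η h₁ h₂ h₃
      have h₃ : s < y + η := h₃
      by_cases hy : y ∈ W'
      · exact iff_of_true hy (hW ⟨h₃, by linarith [h₁.1 hy]⟩)
      · exact iff_of_false hy fun h' => h₂ (le_antisymm (by linarith [(hW₂ h').2]) (not_lt.1 (mt h₁.2 hy)))
    · filter_upwards [hadd.eventually
        (Ioi_mem_nhds (show s + goldenRatio / 2 < y + (s - s') by linarith))] with η hη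
      exact iff_of_false (fun h'' => absurd (hW₂' h'').2 (not_le.2 h'))
        (fun h'' => absurd (hW₂ h'').2 (not_le.2 hη))

open Real in
/-- Every patch of a half-Fibonacci set occurs in every other half-Fibonacci set. -/
theorem IsHalfFibonacci.patches {Λ Λ' : Set ℝ} (h : IsHalfFibonacci Λ) (h' : IsHalfFibonacci Λ')
    (R : ℝ) : ∃ τ : ℝ, ∀ x, |x| ≤ R → (x ∈ Λ' ↔ x ∈ translate Λ τ) := by
  obtain ⟨s, W, hW, hW₂, rfl⟩ := h
  obtain ⟨s', W', hW', hW₂', rfl⟩ := h'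
  have hφ := goldenRatio_pos
  have hφ₁ := goldenRatio_half_lt_one
  -- Translation by `c + dφ` shifts the window by `c + dψ`. With that shift within `1` of `s - s'`,
  -- a point in either window has second coordinate between `s' - 1` and `s' + 2`, so only finitely
  -- many lattice points need checking.
  suffices H : ∃ c d : ℤ, |(c + d * goldenConj : ℝ) - (s - s')| < 1 ∧
      ∀ p ∈ {p : ℤ × ℤ | |(p.1 + p.2 * goldenRatio : ℝ)| ≤ R ∧
        |(p.1 + p.2 * goldenConj : ℝ)| ≤ |s'| + 2},
      ((p.1 + p.2 * goldenConj : ℝ) ∈ W' ↔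
        (p.1 + p.2 * goldenConj : ℝ) + (c + d * goldenConj) ∈ W) by
    obtain ⟨c, d, hcd, H⟩ := H
    rw [abs_lt] at hcd
    have hs := abs_le.1 (le_refl |s'|)
    refine ⟨c + d * goldenRatio, fun x hx => ?_⟩
    rw [mem_translate]
    constructor
    · rintro ⟨a, b, rfl, hab⟩
      have hb := hW₂' hab
      refine ⟨a + c, b + d, by push_cast; ring, ?_⟩
      convert (H (a, b) ⟨hx, abs_le.2 ⟨by linarith [hb.1], by linarith [hb.2]⟩⟩).1 hab using 1
      push_cast
      ring
    · rintro ⟨a, b, hab', hab⟩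
      have hb := hW₂ hab
      have hx' : x = (a - c : ℤ) + (b - d : ℤ) * goldenRatio := by push_cast; linarith
      have hy : ((a - c : ℤ) + (b - d : ℤ) * goldenConj : ℝ) =
        a + b * goldenConj - (c + d * goldenConj) := by push_cast; ring
      refine ⟨a - c, b - d, hx', (H (a - c, b - d) ⟨?_, ?_⟩).2 ?_⟩
      · simpa only [← hx'] using hx
      · simp only [hy]
        exact abs_le.2 ⟨by linarith [hb.1], by linarith [hb.2]⟩
      · simpa only [hy, sub_add_cancel] using hab
  have hnear : ∀ᶠ η in 𝓝 (s - s'), |η - (s - s')| < 1 := Metric.ball_mem_nhds (s - s') one_pos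
  have hends (a b a' b' : ℤ) (h : (a + b * goldenConj : ℝ) = s')
      (h' : (a' + b' * goldenConj : ℝ) = s' + goldenRatio / 2) : False :=
    int_add_mul_goldenConj_ne_half (a' - a) (b' - b) (by push_cast; linarith)
  -- A left endpoint hit by the lattice but excluded, or a right endpoint hit and included, requires
  -- a shift slightly below `s - s'`; the opposite statuses require one slightly above. By `hends`
  -- the two endpoints are never both hit, so the demands cannot conflict.
  by_cases hside : ∃ a b : ℤ, (a + b * goldenConj : ℝ) = s' ∧ s' ∉ W' ∨
      (a + b * goldenConj : ℝ) = s' + goldenRatio / 2 ∧ s' + goldenRatio / 2 ∈ W'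
  · refine exists_int_add_mul_of_eventually_lt goldenConj_irrational
      ((hnear.filter_mono nhdsWithin_le_nhds).and
        ((Filter.eventually_all_finite (finite_lattice_points _ _)).2 fun p _ =>
          eventually_mem_window_iff hW hW₂ hW' hW₂' (nhdsWithin_mono _ fun _ h => ne_of_lt h)
            (fun hp => ?_) (fun hp => ?_))) <;>
      filter_upwards [self_mem_nhdsWithin] with η hη <;> obtain ⟨a, b, h | h⟩ := hside
    · exact iff_of_false (hp ▸ h.2) (not_lt.2 (le_of_lt hη))
    · exact (hends _ _ _ _ hp h.1).elim
    · exact (hends _ _ _ _ h.1 hp).elim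
    · exact iff_of_true (hp ▸ h.2) hη
  · push Not at hside
    refine exists_int_add_mul_of_eventually_gt goldenConj_irrational
      ((hnear.filter_mono nhdsWithin_le_nhds).and
        ((Filter.eventually_all_finite (finite_lattice_points _ _)).2 fun p _ =>
          eventually_mem_window_iff hW hW₂ hW' hW₂' (nhdsWithin_mono _ fun _ h => ne_of_gt h)
            (fun hp => ?_) (fun hp => ?_))) <;>
      filter_upwards [self_mem_nhdsWithin] with η hη
    · exact iff_of_true (hp ▸ (hside p.1 p.2).1 hp) hη
    · exact iff_of_false (hp ▸ (hside p.1 p.2).2 hp) (not_lt.2 (le_of_lt hη))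

theorem isHalfFibonacci_halfFibonacci (u : ℝ) : IsHalfFibonacci (halfFibonacci u) :=
  ⟨u, _, Ioo_subset_Ico_self, Ico_subset_Icc_self, rfl⟩

theorem IsHalfFibonacci.hull_eq {Λ Λ' : Set ℝ} (h : IsHalfFibonacci Λ)
    (h' : IsHalfFibonacci Λ') : hull Λ' = hull Λ :=
  (hull_subset_of_patches (h.patches h')).antisymm (hull_subset_of_patches (h'.patches h))

theorem IsHalfFibonacci.mem_hull {Λ Λ' : Set ℝ} (h : IsHalfFibonacci Λ)
    (h' : IsHalfFibonacci Λ') : Λ' ∈ hull Λ :=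
  h.hull_eq h' ▸ mem_hull_self h'.isClosed

end HalfFib

theorem mainTheorem8 (Λ : Set ℝ) (hΛ : HalfFib.IsHalfFibonacci Λ) :
    (∀ Λ' : Set ℝ, HalfFib.IsHalfFibonacci Λ' →
      Λ' ∈ HalfFib.hull Λ ∧ HalfFib.hull Λ' = HalfFib.hull Λ) ∧
    (∀ Γ ∈ HalfFib.hull Λ, HalfFib.IsDelone Γ) ∧
    HalfFib.bdCard (HalfFib.hull Λ) = Cardinal.continuum := by
  refine ⟨fun Λ' h' => ⟨hΛ.mem_hull h', hΛ.hull_eq h'⟩, fun Γ hΓ => ?_, le_antisymm ?_ ?_⟩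
  · obtain ⟨R, hR⟩ := hΛ.exists_abs_sub_le
    exact HalfFib.isDelone_of_mem_hull one_pos hΛ.pairwise_one_le hR hΓ
  · exact HalfFib.bdCard_le_continuum fun Γ hΓ => hΓ.1
  · exact HalfFib.continuum_le_bdCard fun u =>
      hΛ.mem_hull (HalfFib.isHalfFibonacci_halfFibonacci u)
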